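/- **Theorem (Generalized bulls).** A composition $I=i_1i_2\cdots i_s\vDash n$ is a sequence of positive integers with sum $n$; write $i_{-1}=i_s$ for its last part, $w_I=i_1\prod_{j\ge2}(i_j-1)$, and $e_I=e_{i_1}e_{i_2}\cdots e_{i_s}$, where $e_k$ is the $k$-th elementary symmetric function in countably many variables $x_1,x_2,\dots$. For $0\le a\le n$ let $$\Theta_I^+(a)=\min\{\,i_1+\dots+i_k : 0\le k\le s,\ i_1+\dots+i_k\ge a\,\}-a .$$ For $J\vDash n-1$ let $J1\vDash n$ be the composition obtained by appending a part $1$ to $J$. The chromatic symmetric function of a finite graph $G$ is $X_G=\sum_\kappa\prod_{v\in V(G)}x_{\kappa(v)}$, the sum over all proper colorings $\kappa:V(G)\to\{1,2,\dots\}$. The $K$-chain $K(I)$ is the graph on the disjoint union of sets $V_1,\dots,V_s$ with $V_j=\{v_{j1},\dots,v_{ji_j}\}$ in which two distinct vertices are adjacent exactly when both lie in $V_1$, or both lie in $V_j\cup\{v_{(j-1)i_{j-1}}\}$ for some $2\le j\le s$. Then for all integers $a\ge1$ and $n\ge a+2$, the generalized bull $K(1^a21^{n-a-2})$ satisfies $$X_{K(1^{a}21^{n-a-2})}=\sum_{\substack{I\vDash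 n,\ i_{-1}\ge3\\ \Theta_I^+(a)\le1}}\frac{i_{-1}-2}{i_{-1}-1}\,w_Ie_I+\sum_{\substack{I\vDash n\\ \Theta_I^+(a)\ge2}}2w_Ie_I+\sum_{\substack{J\vDash n-1\\ \Theta_J^+(a)\ge2}}w_Je_{J1}.$$ -/

import Mathlib

noncomputable section

/-- The exponent vector of the monomial `∏ v, x_{κ v}`. -/
def colorMonomial {V : Type*} [Fintype V] (κ : V → ℕ) : ℕ →₀ ℕ :=
  ∑ v, Finsupp.single (κ v) 1

/-- Only finitely many maps give a prescribed monomial, so the cardinality used in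
`chromaticSymm` is that of a finite set. -/
theorem finite_colorMonomial_fiber {V : Type*} [Fintype V] (G : SimpleGraph V) (d : ℕ →₀ ℕ) :
    Finite {κ : G.Coloring ℕ // colorMonomial κ = d} := by
  have key : ∀ (κ : V → ℕ) (v : V), colorMonomial κ = d → κ v ∈ d.support := by
    rintro κ v rfl
    rw [Finsupp.mem_support_iff, colorMonomial, Finsupp.finsetSum_apply]
    have h := Finset.single_le_sum (f := fun u => (Finsupp.single (κ u) 1 : ℕ →₀ ℕ) (κ v))
      (fun _ _ => Nat.zero_le _) (Finset.mem_univ v)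
    simp only [Finsupp.single_eq_same] at h
    omega
  refine Finite.of_injective
    (fun κ => fun v => (⟨κ.1 v, key κ.1 v κ.2⟩ : d.support)) ?_
  intro κ κ' h
  apply Subtype.ext
  apply RelHom.ext
  intro v
  exact congrArg Subtype.val (congrFun h v)

/-- The chromatic symmetric function `X_G = ∑_κ ∏_v x_{κ v}`, the sum over all proper colorings
of `G` by the countable set of colors `ℕ`, as a formal power series in `x_0, x_1, …`: the
coefficient of a monomial is the number of proper colorings that contribute it. -/
def chromaticSymm {V : Type*} [Fintype V] (G : SimpleGraph V) : MvPowerSeries ℕ ℚ :=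
  fun d => (Nat.card {κ : G.Coloring ℕ // colorMonomial κ = d} : ℚ)

open Classical in
/-- The elementary symmetric function `e_k = ∑_{j_1 < ⋯ < j_k} x_{j_1} ⋯ x_{j_k}`, as the sum of
all squarefree monomials of degree `k`. -/
def elemSymm (k : ℕ) : MvPowerSeries ℕ ℚ :=
  fun d => if (∀ j, d j ≤ 1) ∧ d.degree = k then 1 else 0

/-- `e_I = e_{i_1} e_{i_2} ⋯` for a composition `I = i_1 i_2 ⋯`. -/
def elemSymmComp {n : ℕ} (I : Composition n) : MvPowerSeries ℕ ℚ :=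
  (I.blocks.map elemSymm).prod

/-- `w_I = i_1 (i_2 - 1) (i_3 - 1) ⋯`. -/
def compWeight {n : ℕ} (I : Composition n) : ℚ :=
  (I.blocks.headD 1 : ℚ) * (I.blocks.tail.map fun i : ℕ => (i : ℚ) - 1).prod

/-- The last part `i_{-1}` of a composition (`0` for the empty composition). -/
def lastPart {n : ℕ} (I : Composition n) : ℕ :=
  I.blocks.getLastD 0

/-- The surplus partial sum `σ⁺_I(a)`, for `a ≤ |I|`: the least partial sum
`i_1 + ⋯ + i_k` with `0 ≤ k ≤ ℓ(I)` that is at least `a`. -/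
def surplusSum {n : ℕ} (I : Composition n) (a : ℕ) : ℕ :=
  sInf {s : ℕ | ∃ k ≤ I.length, s = I.sizeUpTo k ∧ a ≤ s}

/-- The `a`-surplus `Θ⁺_I(a) = σ⁺_I(a) - a`, for `a ≤ |I|` (so that `a ≤ σ⁺_I(a)`). -/
def surplus {n : ℕ} (I : Composition n) (a : ℕ) : ℕ :=
  surplusSum I a - a

/-- The `K`-chain `K(I)`. Its vertices are `v_{jk}` with `1 ≤ j ≤ ℓ(I)`, `1 ≤ k ≤ i_j` (here
counted from `0`). The `j`-th block of vertices together with the last vertex of the preceding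
block (if there is one) is a clique, and there are no other edges. -/
def kChain {n : ℕ} (I : Composition n) :
    SimpleGraph (Σ j : Fin I.length, Fin (I.blocksFun j)) where
  Adj u v := u ≠ v ∧
    (u.1 = v.1 ∨
      ((u.1 : ℕ) + 1 = v.1 ∧ (u.2 : ℕ) + 1 = I.blocksFun u.1) ∨
      ((v.1 : ℕ) + 1 = u.1 ∧ (v.2 : ℕ) + 1 = I.blocksFun v.1))
  symm := ⟨by
    rintro u v ⟨h, h'⟩
    refine ⟨h.symm, ?_⟩
    rcases h' with h' | h' | h'
    · exact Or.inl h'.symm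
    · exact Or.inr (Or.inr h')
    · exact Or.inr (Or.inl h')⟩
  loopless := ⟨fun _ h => h.1 rfl⟩

/-- The composition `1^a 2 1^{n-a-2}` of `n`. -/
def bullComposition (a n : ℕ) (h : a + 2 ≤ n) : Composition n where
  blocks := List.replicate a 1 ++ 2 :: List.replicate (n - a - 2) 1
  blocks_pos := by
    intro i hi
    simp only [List.mem_append, List.mem_cons, List.mem_replicate] at hi
    omega
  blocks_sum := by
    simp only [List.sum_append, List.sum_cons, List.sum_replicate, smul_eq_mul]
    omega

end

/-! Let `P m` be the chromatic symmetric function of the path on `m` vertices. The bull is a path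
with one extra chord, that is, a triangle with tails growing from two of its corners. For fixed
colors `i ≠ j` at these corners the third corner contributes `e_1 - x_i - x_j`, and expanding gives
`X = 2 P n + e_1 P (n-1) - P a P (n-a) - P (a+1) P (n-a-1)` (`sum_pathEnd_triangle`,
`chromaticFin_bullGraph`).

A generating function in the path length gives a recursion for `P` (`pathTotal_rec`), which is
solved by `P n = ∑ w_I e_I` (`eq_sum_blockLists_of_rec`). Reversing the compositions of the second
factor writes `P c P (n-c)` as a sum over the compositions having `c` as a partial sum, with weight
`i_{-1}` times the weight of `I` without its last part (`sum_blockLists_mul_sum_blockLists`).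

Now compare coefficients in `bull_combination_eq`. If neither `a` nor `a+1` is a partial sum
(surplus at least 2), only `2 w_I` remains. Otherwise, with `k = i_{-1}` and `w'` the weight of `I`
without its last part, the coefficient is `2(k-1)w' - k w' = (k-2)w'`. This is `(k-2)/(k-1) w_I` for
`k ≥ 3` and zero for `k = 2`; for `k = 1` it is `-w'`, which cancels the terms of `e_1 P (n-1)` with
`J` of surplus at most 1.

Colorings are summed in finitely many variables; this suffices because a given coefficient involves
only finitely many of them. -/

/-! ### Compositions as lists of parts, partial sums and surplus. -/

open Finset in
/-- The block lists of the compositions of `n`. -/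
def blockLists (n : ℕ) : Finset (List ℕ) :=
  (univ : Finset (Composition n)).image Composition.blocks

theorem mem_blockLists {n : ℕ} {l : List ℕ} :
    l ∈ blockLists n ↔ (∀ i ∈ l, 0 < i) ∧ l.sum = n := by
  simp only [blockLists, Finset.mem_image, Finset.mem_univ, true_and]
  constructor
  · rintro ⟨I, rfl⟩
    exact ⟨fun i hi => I.blocks_pos hi, I.blocks_sum⟩
  · rintro ⟨h, h'⟩
    exact ⟨⟨l, fun {i} hi => h i hi, h'⟩, rfl⟩

theorem sum_composition_eq {M : Type*} [AddCommMonoid M] {n : ℕ} (f : List ℕ → M) :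
    ∑ I : Composition n, f I.blocks = ∑ l ∈ blockLists n, f l := by
  rw [blockLists, Finset.sum_image]
  intro I _ J _ h
  exact Composition.ext h

/-- `i_1 (i_2 - 1) (i_3 - 1) ⋯` for a list of parts. -/
def listWeight (l : List ℕ) : ℚ :=
  (l.headD 1 : ℚ) * (l.tail.map fun i : ℕ => (i : ℚ) - 1).prod

theorem listWeight_nil : listWeight [] = 1 := by simp [listWeight]

theorem listWeight_cons (k : ℕ) (l : List ℕ) :
    listWeight (k :: l) = k * (l.map fun i : ℕ => (i : ℚ) - 1).prod := by simp [listWeight]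

theorem listWeight_append {l : List ℕ} (hl : l ≠ []) (m : List ℕ) :
    listWeight (l ++ m) = listWeight l * (m.map fun i : ℕ => (i : ℚ) - 1).prod := by
  cases l with
  | nil => exact absurd rfl hl
  | cons a l => simp [listWeight_cons, mul_assoc]

/-- `s` is a partial sum of `l`. -/
def IsPartialSum (l : List ℕ) (s : ℕ) : Prop := ∃ m, m <+: l ∧ m.sum = s

/-- Removes the infimum: the least partial sum that is at least `a` exists because `n` itself is
one, and the surplus is at most 1 exactly when it is `a` or `a + 1`. -/
theorem surplus_le_one_iff {n a : ℕ} (I : Composition n) (h : a + 1 ≤ n) :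
    surplus I a ≤ 1 ↔ IsPartialSum I.blocks a ∨ IsPartialSum I.blocks (a + 1) := by
  have key : ∀ s, (∃ k ≤ I.length, s = I.sizeUpTo k) ↔ IsPartialSum I.blocks s := by
    intro s
    constructor
    · rintro ⟨k, -, rfl⟩
      exact ⟨I.blocks.take k, List.take_prefix _ _, rfl⟩
    · rintro ⟨m, hm, rfl⟩
      refine ⟨m.length, hm.length_le, ?_⟩
      rw [Composition.sizeUpTo, ← List.prefix_iff_eq_take.1 hm]
  have hne : {s : ℕ | ∃ k ≤ I.length, s = I.sizeUpTo k ∧ a ≤ s}.Nonempty :=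
    ⟨n, I.length, le_rfl, I.sizeUpTo_length.symm, by omega⟩
  rw [surplus, surplusSum, ← key, ← key]
  constructor
  · intro hs
    obtain ⟨k, hk, hk', hle⟩ := Nat.sInf_mem hne
    set s := sInf {s : ℕ | ∃ k ≤ I.length, s = I.sizeUpTo k ∧ a ≤ s}
    rcases (by omega : s = a ∨ s = a + 1) with h1 | h1
    · exact Or.inl ⟨k, hk, by omega⟩
    · exact Or.inr ⟨k, hk, by omega⟩
  · rintro (⟨k, hk, h1⟩ | ⟨k, hk, h1⟩)
    · have := Nat.sInf_le (s := {s : ℕ | ∃ k ≤ I.length, s = I.sizeUpTo k ∧ a ≤ s})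
        ⟨k, hk, h1, le_rfl⟩
      omega
    · have := Nat.sInf_le (s := {s : ℕ | ∃ k ≤ I.length, s = I.sizeUpTo k ∧ a ≤ s})
        ⟨k, hk, h1, Nat.le_succ a⟩
      omega

/-- With positive parts the partial sums increase strictly, so a composition can be cut at a given
partial sum in only one way. -/
theorem eq_of_prefix_of_sum_eq {l m m' : List ℕ} (hl : ∀ i ∈ l, 0 < i) (h : m <+: l)
    (h' : m' <+: l) (hs : m.sum = m'.sum) : m = m' := by
  wlog hle : m.length ≤ m'.length generalizing m m'
  · exact (this h' h hs.symm (by omega)).symm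
  obtain ⟨t, rfl⟩ := List.prefix_of_prefix_length_le h h' hle
  cases t with
  | nil => simp
  | cons k t =>
    have := hl k (h'.subset (by simp))
    simp at hs
    omega

theorem prod_map_append_singleton {R : Type*} [CommRing R] (e : ℕ → R) (l : List ℕ) (k : ℕ) :
    ((l ++ [k]).map e).prod = (l.map e).prod * e k := by simp

theorem sum_blockLists_eq_sum_append {M : Type*} [AddCommMonoid M] {n : ℕ} (hn : 1 ≤ n)
    (f : List ℕ → M) :
    ∑ l ∈ blockLists n, f l =
      ∑ k ∈ Finset.Icc 1 n, ∑ l ∈ blockLists (n - k), f (l ++ [k]) := by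
  rw [Finset.sum_sigma']
  symm
  refine Finset.sum_bij (fun p _ => p.2 ++ [p.1]) ?_ ?_ ?_ ?_
  · rintro ⟨k, l⟩ h
    simp only [Finset.mem_sigma, Finset.mem_Icc, mem_blockLists] at h
    obtain ⟨hk, hl, hs⟩ := h
    rw [mem_blockLists]
    refine ⟨fun i hi => ?_, ?_⟩
    · rcases List.mem_append.1 hi with hi | hi
      · exact hl i hi
      · simp at hi; omega
    · simp; omega
  · rintro ⟨k, l⟩ _ ⟨k', l'⟩ _ h
    obtain ⟨h1, h2⟩ := List.append_inj' h rfl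
    simp at h1 h2
    subst h1 h2
    rfl
  · intro l hl
    rw [mem_blockLists] at hl
    have hne : l ≠ [] := by rintro rfl; simp at hl; omega
    have hdl := List.dropLast_append_getLast hne
    have hs : l.dropLast.sum + l.getLast hne = n := by
      rw [← hl.2]; conv_rhs => rw [← hdl]
      simp
    have hp := hl.1 _ (List.getLast_mem hne)
    refine ⟨⟨l.getLast hne, l.dropLast⟩, ?_, hdl⟩
    simp only [Finset.mem_sigma, Finset.mem_Icc, mem_blockLists]
    exact ⟨by omega, fun i hi => hl.1 i (List.dropLast_subset l hi), by omega⟩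
  · intros; rfl

/-! ### From the path recursion to sums over compositions. -/

section Ring

variable {R : Type*} [CommRing R] [Algebra ℚ R]

/-- A sequence satisfying the recursion of the path chromatic symmetric functions is given by the
weighted sum over compositions. -/
theorem eq_sum_blockLists_of_rec {e P : ℕ → R} (h0 : P 0 = 1)
    (hP : ∀ n, 1 ≤ n →
      P n = e n + ∑ k ∈ Finset.Icc 1 n, ((k : ℚ) - 1) • (e k * P (n - k))) (n : ℕ) :
    P n = ∑ l ∈ blockLists n, listWeight l • (l.map e).prod := by
  induction n using Nat.strong_induction_on with
  | _ n ih =>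
    have hz : blockLists 0 = {[]} := by
      ext l
      rw [mem_blockLists, Finset.mem_singleton]
      constructor
      · rintro ⟨h1, h2⟩
        cases l with
        | nil => rfl
        | cons k l => have := h1 k (by simp); simp at h2; omega
      · rintro rfl; simp
    rcases Nat.eq_zero_or_pos n with rfl | hn
    · simp [hz, h0, listWeight_nil]
    rw [hP n hn, sum_blockLists_eq_sum_append hn]
    obtain ⟨m, rfl⟩ : ∃ m, n = m + 1 := ⟨n - 1, by omega⟩
    -- The term `k = n` is the composition with a single part. There `e n` and `(n - 1) e n` add up
    -- to `n e n`, which is why the first part has weight `i_1` and not `i_1 - 1`.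
    rw [← Finset.insert_Icc_right_eq_Icc_add_one (by omega), Finset.sum_insert (by simp),
      Finset.sum_insert (by simp), ← add_assoc]
    congr 1
    · simp only [Nat.sub_self, hz, h0, mul_one, Finset.sum_singleton, List.nil_append,
        listWeight_cons, List.map_nil, List.prod_nil, List.map_cons, List.prod_cons, sub_smul,
        one_smul]
      abel
    · refine Finset.sum_congr rfl fun k hk => ?_
      rw [Finset.mem_Icc] at hk
      rw [ih _ (by omega), Finset.mul_sum, Finset.smul_sum]
      refine Finset.sum_congr rfl fun l hl => ?_
      rw [mem_blockLists] at hl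
      have hne : l ≠ [] := by rintro rfl; simp at hl; omega
      rw [listWeight_append hne, prod_map_append_singleton, mul_smul_comm, smul_smul]
      simp only [List.map_cons, List.map_nil, List.prod_cons, List.prod_nil, mul_one]
      rw [mul_comm (e k), mul_comm ((k : ℚ) - 1)]

theorem sum_blockLists_reverse {M : Type*} [AddCommMonoid M] {n : ℕ} (f : List ℕ → M) :
    ∑ l ∈ blockLists n, f l.reverse = ∑ l ∈ blockLists n, f l :=
  Finset.sum_nbij' List.reverse List.reverse
    (by intro l; simp [mem_blockLists]) (by intro l; simp [mem_blockLists])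
    (by simp) (by simp) (by simp)

/-- Concatenation is a bijection from pairs of compositions onto compositions cut at `a`. The second
composition is reversed first, so that its distinguished factor sits on the last part of the
concatenation and all parts around the cut, except the very first, carry `i - 1`. -/
theorem sum_blockLists_mul_sum_blockLists (e : ℕ → R) {a b : ℕ} (ha : 1 ≤ a) (hb : 1 ≤ b)
    [DecidablePred fun l => IsPartialSum l a] :
    (∑ l ∈ blockLists a, listWeight l • (l.map e).prod) *
        (∑ l ∈ blockLists b, listWeight l • (l.map e).prod) =
      ∑ l ∈ blockLists (a + b) with IsPartialSum l a,
        ((l.getLastD 0 : ℚ) * listWeight l.dropLast) • (l.map e).prod := by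
  rw [← sum_blockLists_reverse (n := b), Finset.sum_mul_sum, Finset.sum_sigma']
  refine Finset.sum_bij (fun p _ => p.1 ++ p.2) ?_ ?_ ?_ ?_
  · rintro ⟨l, m⟩ h
    simp only [Finset.mem_sigma, mem_blockLists] at h
    obtain ⟨⟨h1, h2⟩, h3, h4⟩ := h
    rw [Finset.mem_filter, mem_blockLists]
    refine ⟨⟨fun i hi => ?_, by simp [h2, h4]⟩, l, List.prefix_append _ _, h2⟩
    rcases List.mem_append.1 hi with hi | hi
    exacts [h1 i hi, h3 i hi]
  · rintro ⟨l, m⟩ h ⟨l', m'⟩ h' heq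
    simp only [Finset.mem_sigma, mem_blockLists] at h h'
    obtain ⟨⟨h1, h2⟩, h3, h4⟩ := h
    obtain ⟨⟨h1', h2'⟩, h3', h4'⟩ := h'
    dsimp only at heq
    have hl : l = l' := by
      refine eq_of_prefix_of_sum_eq (l := l ++ m) ?_ (List.prefix_append _ _) ?_ (h2.trans h2'.symm)
      · intro i hi
        rcases List.mem_append.1 hi with hi | hi
        exacts [h1 i hi, h3 i hi]
      · rw [heq]; exact List.prefix_append _ _
    subst hl
    rw [List.append_cancel_left heq]
  · intro l hl
    rw [Finset.mem_filter, mem_blockLists] at hl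
    obtain ⟨⟨h1, h2⟩, m, ⟨t, rfl⟩, hm⟩ := hl
    refine ⟨⟨m, t⟩, ?_, rfl⟩
    simp only [Finset.mem_sigma, mem_blockLists]
    rw [List.sum_append] at h2
    exact ⟨⟨fun i hi => h1 i (by simp [hi]), hm⟩, fun i hi => h1 i (by simp [hi]), by omega⟩
  · rintro ⟨l, m⟩ h
    simp only [Finset.mem_sigma, mem_blockLists] at h
    obtain ⟨⟨h1, h2⟩, h3, h4⟩ := h
    have hl : l ≠ [] := by rintro rfl; simp at h2; omega
    have hm : m ≠ [] := by rintro rfl; simp at h4; omega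
    dsimp only
    obtain ⟨t, k, rfl⟩ : ∃ t k, m = t ++ [k] :=
      ⟨_, _, (List.dropLast_append_getLast hm).symm⟩
    have hw : listWeight (t ++ [k]).reverse = k * (t.map fun i : ℕ => (i : ℚ) - 1).prod := by
      simp [listWeight_cons, List.prod_reverse]
    have hd : (l ++ (t ++ [k])).dropLast = l ++ t := by
      rw [← List.append_assoc, List.dropLast_concat]
    have hg : (l ++ (t ++ [k])).getLastD 0 = k := by
      rw [← List.append_assoc]; simp
    have hr : ((t ++ [k]).reverse.map e).prod = ((t ++ [k]).map e).prod := by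
      rw [List.map_reverse, List.prod_reverse]
    rw [hw, hd, hg, hr, listWeight_append hl, smul_mul_smul_comm, ← List.prod_append,
      ← List.map_append]
    congr 1
    ring

theorem isPartialSum_append_singleton_iff {l : List ℕ} {k s : ℕ} (hk : 0 < k) (h : s ≤ l.sum) :
    IsPartialSum (l ++ [k]) s ↔ IsPartialSum l s := by
  constructor
  · rintro ⟨m, hm, rfl⟩
    rcases List.prefix_concat_iff.1 hm with rfl | hm
    · simp at h; omega
    · exact ⟨m, hm, rfl⟩
  · rintro ⟨m, hm, hs⟩
    exact ⟨m, hm.trans (List.prefix_append _ _), hs⟩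

/-- If `a ≥ 1` and `a + 1 < |l|` are both partial sums, then `l` has a part `1` that is neither the
first nor the last. -/
theorem listWeight_dropLast_eq_zero {l : List ℕ} {a : ℕ} (hl : ∀ i ∈ l, 0 < i) (ha : 1 ≤ a)
    (hs : a + 1 < l.sum) (h : IsPartialSum l a) (h' : IsPartialSum l (a + 1)) :
    listWeight l.dropLast = 0 := by
  obtain ⟨m, hm, hma⟩ := h
  obtain ⟨m', hm', hma'⟩ := h'
  have hmm : m <+: m' := by
    rcases List.prefix_or_prefix_of_prefix hm hm' with h | h
    · exact h
    · have := h.sublist.sum_le_sum (by simp)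
      omega
  obtain ⟨t, rfl⟩ := hmm
  obtain ⟨u, rfl⟩ := hm'
  have ht : t = [1] := by
    rw [List.sum_append] at hma'
    match t with
    | [] => simp at hma'; omega
    | [k] => simp at hma' ⊢; omega
    | k :: k' :: t =>
      have h1 := hl k (by simp)
      have h2 := hl k' (by simp)
      simp at hma'
      omega
  subst ht
  have hu : u ≠ [] := by rintro rfl; simp at hs hma'; omega
  have hm0 : m ≠ [] := by rintro rfl; simp at hma; omega
  rw [List.append_assoc, List.dropLast_append_of_ne_nil (by simp),
    List.dropLast_append_of_ne_nil hu, listWeight_append hm0]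
  simp

open Classical in
/-- The combination of path chromatic symmetric functions giving the generalized bull, in terms of
compositions. -/
theorem bull_combination_eq {e P : ℕ → R} (h0 : P 0 = 1)
    (hP : ∀ n, 1 ≤ n →
      P n = e n + ∑ k ∈ Finset.Icc 1 n, ((k : ℚ) - 1) • (e k * P (n - k)))
    {a n : ℕ} (ha : 1 ≤ a) (hn : a + 2 ≤ n) :
    2 * P n + e 1 * P (n - 1) - P a * P (n - a) - P (a + 1) * P (n - a - 1) =
      (∑ I : Composition n with 3 ≤ lastPart I ∧ surplus I a ≤ 1,
        ((((lastPart I : ℚ) - 2) / ((lastPart I : ℚ) - 1)) * compWeight I) •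
          (I.blocks.map e).prod) +
      (∑ I : Composition n with 2 ≤ surplus I a,
        (2 * compWeight I) • (I.blocks.map e).prod) +
      (∑ J : Composition (n - 1) with 2 ≤ surplus J a,
        compWeight J • ((J.append (Composition.single 1 one_pos)).blocks.map e).prod) := by
  set S : List ℕ → Prop := fun l => IsPartialSum l a ∨ IsPartialSum l (a + 1) with hS
  have hsur : ∀ I : Composition n, surplus I a ≤ 1 ↔ S I.blocks :=
    fun I => surplus_le_one_iff I (by omega)
  have hsur2 : ∀ I : Composition n, 2 ≤ surplus I a ↔ ¬ S I.blocks := by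
    intro I; rw [← hsur]; omega
  have hsur' : ∀ I : Composition (n - 1), 2 ≤ surplus I a ↔ ¬ S I.blocks := by
    intro I
    have := surplus_le_one_iff (a := a) I (by omega)
    change 2 ≤ surplus I a ↔ ¬ (_ ∨ _)
    rw [← this]
    omega
  have hA : (∑ I : Composition n with 3 ≤ lastPart I ∧ surplus I a ≤ 1,
        ((((lastPart I : ℚ) - 2) / ((lastPart I : ℚ) - 1)) * compWeight I) •
          (I.blocks.map e).prod) =
      ∑ l ∈ blockLists n, if 3 ≤ l.getLastD 0 ∧ S l then
        ((((l.getLastD 0 : ℚ) - 2) / ((l.getLastD 0 : ℚ) - 1)) * listWeight l) •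
          (l.map e).prod else 0 := by
    rw [← sum_composition_eq, Finset.sum_filter]
    simp only [hsur]
    rfl
  have hB : (∑ I : Composition n with 2 ≤ surplus I a,
        (2 * compWeight I) • (I.blocks.map e).prod) =
      ∑ l ∈ blockLists n, if S l then 0 else (2 * listWeight l) • (l.map e).prod := by
    rw [← sum_composition_eq, Finset.sum_filter]
    simp only [hsur2, ite_not]
    rfl
  have hC : (∑ J : Composition (n - 1) with 2 ≤ surplus J a,
        compWeight J • ((J.append (Composition.single 1 one_pos)).blocks.map e).prod) =
      ∑ l ∈ blockLists (n - 1), if S l then 0 else listWeight l • ((l ++ [1]).map e).prod := by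
    rw [← sum_composition_eq, Finset.sum_filter]
    simp only [hsur', ite_not]
    rfl
  -- Compositions of `n` ending in 1 are the `J1`; since `a + 1 ≤ n - 1`, the appended part does not
  -- affect whether `a` or `a + 1` is a partial sum.
  have hD : (∑ l ∈ blockLists n, if l.getLastD 0 = 1 ∧ S l then
        listWeight l.dropLast • (l.map e).prod else 0) =
      ∑ l ∈ blockLists (n - 1), if S l then listWeight l • ((l ++ [1]).map e).prod else 0 := by
    rw [sum_blockLists_eq_sum_append (by omega), Finset.sum_eq_single_of_mem 1
      (by simp; omega)]
    · refine Finset.sum_congr rfl fun l hl => ?_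
      rw [mem_blockLists] at hl
      have hiff : S (l ++ [1]) ↔ S l := by
        simp only [hS]
        rw [isPartialSum_append_singleton_iff one_pos (by omega),
          isPartialSum_append_singleton_iff one_pos (by omega)]
      simp [hiff]
    · intro k _ hk
      refine Finset.sum_eq_zero fun l _ => ?_
      simp [hk]
  have hE : e 1 * P (n - 1) =
      ∑ l ∈ blockLists (n - 1), listWeight l • ((l ++ [1]).map e).prod := by
    rw [eq_sum_blockLists_of_rec h0 hP, Finset.mul_sum]
    refine Finset.sum_congr rfl fun l _ => ?_
    rw [prod_map_append_singleton, mul_smul_comm, mul_comm]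
  have hprod : ∀ c, 1 ≤ c → c < n → P c * P (n - c) =
      ∑ l ∈ blockLists n, if IsPartialSum l c then
        ((l.getLastD 0 : ℚ) * listWeight l.dropLast) • (l.map e).prod else 0 := by
    intro c hc hcn
    rw [eq_sum_blockLists_of_rec h0 hP c, eq_sum_blockLists_of_rec h0 hP (n - c),
      sum_blockLists_mul_sum_blockLists e hc (by omega), Finset.sum_filter,
      Nat.add_sub_cancel' hcn.le]
  have hCD : (∑ l ∈ blockLists (n - 1), if S l then 0 else
        listWeight l • ((l ++ [1]).map e).prod) = e 1 * P (n - 1) -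
      ∑ l ∈ blockLists n, if l.getLastD 0 = 1 ∧ S l then
        listWeight l.dropLast • (l.map e).prod else 0 := by
    rw [hD, hE, ← Finset.sum_sub_distrib]
    refine Finset.sum_congr rfl fun l _ => ?_
    split_ifs <;> simp
  rw [hA, hB, hC, hCD, Nat.sub_sub n a 1, hprod a ha (by omega),
    hprod (a + 1) (by omega) (by omega), two_mul, eq_sum_blockLists_of_rec h0 hP n]
  -- Everything is now a sum over compositions of `n`, apart from `e 1 * P (n - 1)`, which cancels;
  -- the identity is checked term by term.
  suffices h : ∀ l ∈ blockLists n,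
      listWeight l • (l.map e).prod + listWeight l • (l.map e).prod -
        (if IsPartialSum l a then
          ((l.getLastD 0 : ℚ) * listWeight l.dropLast) • (l.map e).prod else 0) -
        (if IsPartialSum l (a + 1) then
          ((l.getLastD 0 : ℚ) * listWeight l.dropLast) • (l.map e).prod else 0) =
      (if 3 ≤ l.getLastD 0 ∧ S l then
        ((((l.getLastD 0 : ℚ) - 2) / ((l.getLastD 0 : ℚ) - 1)) * listWeight l) •
          (l.map e).prod else 0) +
      (if S l then 0 else (2 * listWeight l) • (l.map e).prod) -
      (if l.getLastD 0 = 1 ∧ S l then listWeight l.dropLast • (l.map e).prod else 0) by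
    have := Finset.sum_congr rfl h
    simp only [Finset.sum_add_distrib, Finset.sum_sub_distrib] at this
    linear_combination this
  intro l hl
  rw [mem_blockLists] at hl
  obtain ⟨hpos, hsum⟩ := hl
  by_cases hSl : S l
  swap
  · have h1 : ¬ IsPartialSum l a := fun h => hSl (Or.inl h)
    have h2 : ¬ IsPartialSum l (a + 1) := fun h => hSl (Or.inr h)
    simp only [h1, h2, hSl, and_false, if_false, mul_smul, two_smul]
    simp
  have hne : l ≠ [] := by rintro rfl; simp at hsum; omega
  obtain ⟨t, k, rfl⟩ : ∃ t k, l = t ++ [k] := ⟨_, _, (List.dropLast_append_getLast hne).symm⟩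
  have hk : 0 < k := hpos k (by simp)
  -- A single part has no partial sum strictly between 0 and `n`, whereas `0 < a` and `a + 1 < n`.
  have ht : t ≠ [] := by
    rintro rfl
    have key : ∀ s, 0 < s → s < k → ¬ IsPartialSum ([] ++ [k]) s := by
      rintro s hs hsk ⟨m, hm, rfl⟩
      rcases List.prefix_concat_iff.1 hm with rfl | hm
      · simp at hsk
      · simp [List.prefix_nil.1 hm] at hs
    simp at hsum
    rcases hSl with h | h
    · exact key a (by omega) (by omega) h
    · exact key (a + 1) (by omega) (by omega) h
  have hw : listWeight (t ++ [k]) = listWeight t * ((k : ℚ) - 1) := by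
    rw [listWeight_append ht]; simp
  have hg : (t ++ [k]).getLastD 0 = k := by simp
  have hd : (t ++ [k]).dropLast = t := by simp
  -- The two products together contribute once: if both `a` and `a + 1` are partial sums, the
  -- interior part 1 between them makes the weight vanish.
  have hpp : (if IsPartialSum (t ++ [k]) a then
          ((k : ℚ) * listWeight t) • ((t ++ [k]).map e).prod else 0) +
        (if IsPartialSum (t ++ [k]) (a + 1) then
          ((k : ℚ) * listWeight t) • ((t ++ [k]).map e).prod else 0) =
      ((k : ℚ) * listWeight t) • ((t ++ [k]).map e).prod := by
    by_cases h1 : IsPartialSum (t ++ [k]) a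
    · by_cases h2 : IsPartialSum (t ++ [k]) (a + 1)
      · have := listWeight_dropLast_eq_zero hpos ha (by omega) h1 h2
        rw [hd] at this
        simp [this]
      · simp [h1, h2]
    · have h2 : IsPartialSum (t ++ [k]) (a + 1) := hSl.resolve_left h1
      simp [h1, h2]
  rw [hg, hd, sub_sub, hpp, hw]
  simp only [hSl, and_true, if_true, add_zero]
  rw [← add_smul, ← sub_smul]
  rcases (by omega : k = 1 ∨ k = 2 ∨ 3 ≤ k) with rfl | rfl | h3
  · simp
  · norm_num
    left; ring
  · have h1 : k ≠ 1 := by omega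
    have h2 : (k : ℚ) - 1 ≠ 0 := by
      have : (3 : ℚ) ≤ k := by exact_mod_cast h3
      linarith
    simp only [h3, h1, if_true, if_false, sub_zero]
    congr 1
    field_simp
    ring

end Ring

/-! ### Path generating functions in finitely many variables. -/

section FiniteVariables

variable {ι R : Type*} [Fintype ι] [CommRing R]

/-- The generating function of the proper colorings of a path with `m + 1` vertices by `ι`, in
which the first vertex has color `i`. -/
def pathEnd (x : ι → R) : ℕ → ι → R
  | 0, i => x i
  | m + 1, i => x i * (∑ j, pathEnd x m j - pathEnd x m i)

/-- The generating function of the proper colorings of a path with `m` vertices by `ι`. -/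
def pathTotal (x : ι → R) : ℕ → R
  | 0 => 1
  | m + 1 => ∑ i, pathEnd x m i

/-- The elementary symmetric polynomial of degree `k` evaluated at the family `x`. -/
noncomputable def elemSymmFin (x : ι → R) (k : ℕ) : R :=
  (∏ i, (1 + Polynomial.C (x i) * Polynomial.X)).coeff k

theorem pathEnd_succ (x : ι → R) (m : ℕ) (i : ι) :
    pathEnd x (m + 1) i = x i * (pathTotal x (m + 1) - pathEnd x m i) := rfl

theorem sum_eq_elemSymmFin_one (x : ι → R) : ∑ i, x i = elemSymmFin x 1 := by
  classical
  rw [elemSymmFin]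
  have h : ∀ s : Finset ι, (∏ i ∈ s, (1 + Polynomial.C (x i) * Polynomial.X)).coeff 0 = 1 := by
    intro s
    rw [Polynomial.coeff_zero_prod]
    simp
  suffices ∀ s : Finset ι, ∑ i ∈ s, x i =
      (∏ i ∈ s, (1 + Polynomial.C (x i) * Polynomial.X)).coeff 1 from this _
  intro s
  induction s using Finset.induction_on with
  | empty => simp [Polynomial.coeff_one]
  | insert i s hi ih =>
    rw [Finset.sum_insert hi, Finset.prod_insert hi, add_mul, one_mul, Polynomial.coeff_add, ← ih,
      mul_assoc, Polynomial.coeff_C_mul, Polynomial.coeff_X_mul, h]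
    ring

/-- The generating function of `pathEnd x · i`. -/
noncomputable def pathEndSeries (x : ι → R) (i : ι) : PowerSeries R :=
  PowerSeries.X * PowerSeries.mk fun m => pathEnd x m i

/-- The index `m` of `pathEnd` belongs to `m + 1` vertices, whence the factor `X` in
`pathEndSeries`; the summand 1 is the empty path. -/
theorem mk_pathTotal (x : ι → R) :
    PowerSeries.mk (pathTotal x) = 1 + ∑ i, pathEndSeries x i := by
  ext n
  cases n with
  | zero => simp [pathEndSeries, pathTotal]
  | succ n => simp [pathEndSeries, pathTotal, PowerSeries.coeff_succ_X_mul, PowerSeries.coeff_one]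

theorem one_add_mul_pathEndSeries (x : ι → R) (i : ι) :
    (1 + PowerSeries.C (x i) * PowerSeries.X) * pathEndSeries x i =
      PowerSeries.C (x i) * PowerSeries.X * PowerSeries.mk (pathTotal x) := by
  have h : (PowerSeries.mk fun m => pathEnd x m i) +
      PowerSeries.C (x i) * (PowerSeries.X * PowerSeries.mk fun m => pathEnd x m i) =
      PowerSeries.C (x i) * PowerSeries.mk (pathTotal x) := by
    ext n
    cases n with
    | zero => simp [pathEnd, pathTotal]
    | succ n =>
      simp only [map_add, PowerSeries.coeff_mk, PowerSeries.coeff_C_mul,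
        PowerSeries.coeff_succ_X_mul, pathEnd_succ]
      ring
  rw [pathEndSeries]
  linear_combination PowerSeries.X * h

/-- By `one_add_mul_pathEndSeries`, the series `F_i` for first color `i` satisfies `(1 + x_i z) F_i
= x_i z P`. Multiplying `P = 1 + ∑ F_i` by `E = ∏ (1 + x_i z)` leaves in each summand the product
without its `i`-th factor, and these assemble to `z E'`. -/
theorem elemSymm_series_identity (x : ι → R) :
    let E : Polynomial R := ∏ i, (1 + Polynomial.C (x i) * Polynomial.X)
    (E : PowerSeries R) * PowerSeries.mk (pathTotal x) =
      (E : PowerSeries R) + PowerSeries.X * (Polynomial.derivative E : PowerSeries R) *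
        PowerSeries.mk (pathTotal x) := by
  classical
  intro E
  have hi : ∀ i, (E : PowerSeries R) * pathEndSeries x i =
      ((∏ j ∈ Finset.univ.erase i, (1 + Polynomial.C (x j) * Polynomial.X) : Polynomial R) :
        PowerSeries R) * (PowerSeries.C (x i) * PowerSeries.X * PowerSeries.mk (pathTotal x)) := by
    intro i
    rw [← one_add_mul_pathEndSeries, ← mul_assoc]
    congr 1
    simp only [E]
    rw [← Finset.prod_erase_mul _ _ (Finset.mem_univ i)]
    simp
  have hE : PowerSeries.X * (Polynomial.derivative E : PowerSeries R) =
      ∑ i, ((∏ j ∈ Finset.univ.erase i, (1 + Polynomial.C (x j) * Polynomial.X) :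
        Polynomial R) : PowerSeries R) * (PowerSeries.C (x i) * PowerSeries.X) := by
    simp only [E]
    rw [Polynomial.derivative_prod_finset]
    have : ∀ f : ι → Polynomial R, ((∑ i, f i : Polynomial R) : PowerSeries R) =
        ∑ i, (f i : PowerSeries R) := fun f => map_sum (Polynomial.coeToPowerSeries.ringHom) f _
    rw [this, Finset.mul_sum]
    refine Finset.sum_congr rfl fun i _ => ?_
    simp only [Polynomial.derivative_add, Polynomial.derivative_one, Polynomial.derivative_C_mul,
      Polynomial.derivative_X, zero_add, mul_one, Polynomial.coe_mul, Polynomial.coe_C]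
    ring
  conv_lhs => rw [mk_pathTotal]
  rw [mul_add, mul_one, Finset.mul_sum, hE, Finset.sum_mul]
  congr 1
  refine Finset.sum_congr rfl fun i _ => ?_
  rw [hi]
  ring

theorem pathTotal_rec [Algebra ℚ R] (x : ι → R) (n : ℕ) :
    pathTotal x n = elemSymmFin x n +
      ∑ k ∈ Finset.Icc 1 n, ((k : ℚ) - 1) • (elemSymmFin x k * pathTotal x (n - k)) := by
  have h := congrArg (PowerSeries.coeff n) (elemSymm_series_identity x)
  have hX : ∀ k, PowerSeries.coeff k (PowerSeries.X * (Polynomial.derivative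
      (∏ i, (1 + Polynomial.C (x i) * Polynomial.X)) : PowerSeries R)) =
        (k : R) * elemSymmFin x k := by
    intro k
    cases k with
    | zero => simp
    | succ k =>
      rw [PowerSeries.coeff_succ_X_mul, Polynomial.coeff_coe, Polynomial.coeff_derivative,
        elemSymmFin]
      push_cast
      ring
  have h0 : elemSymmFin x 0 = 1 := by
    rw [elemSymmFin, Polynomial.coeff_zero_prod]
    simp
  simp only [map_add, PowerSeries.coeff_mul (n := n), hX, Polynomial.coeff_coe,
    PowerSeries.coeff_mk] at h
  rw [Finset.Nat.sum_antidiagonal_eq_sum_range_succ_mk,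
    Finset.Nat.sum_antidiagonal_eq_sum_range_succ_mk, ← sub_eq_iff_eq_add,
    ← Finset.sum_sub_distrib, Finset.range_eq_Ico, Finset.sum_eq_sum_Ico_succ_bot (by omega)] at h
  change _ = elemSymmFin x n at h
  have h1 : elemSymmFin x 0 * pathTotal x n - _ + _ = _ := h
  -- The term `k = 0` is `e_0 P_n = P_n`, so the coefficient identity can be solved for it.
  rw [h0] at h1
  rw [← h1, Nat.succ_eq_add_one, Finset.Ico_add_one_right_eq_Icc, zero_add]
  have h2 : ∀ k ∈ Finset.Icc 1 n,
      ((k : ℚ) - 1) • (elemSymmFin x k * pathTotal x (n - k)) =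
      -((∏ i, (1 + Polynomial.C (x i) * Polynomial.X)).coeff k * pathTotal x (n - k) -
        (k : R) * elemSymmFin x k * pathTotal x (n - k)) := by
    intro k _
    rw [sub_smul, one_smul, Algebra.smul_def, map_natCast, elemSymmFin]
    ring
  rw [Finset.sum_congr rfl h2, Finset.sum_neg_distrib]
  simp only [one_mul, Nat.cast_zero, zero_mul, sub_zero, add_neg_cancel_right]

/-- Among colorings of two disjoint paths, those with different end colors are the colorings of the
path obtained by joining these ends. The induction moves one vertex at a time from the first path to
the second. -/
theorem sum_pathEnd_mul_pathEnd (x : ι → R) (a b : ℕ) :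
    ∑ i, pathEnd x a i * pathEnd x b i =
      pathTotal x (a + 1) * pathTotal x (b + 1) - pathTotal x (a + b + 2) := by
  have hx : ∀ b i, x i * pathEnd x b i =
      x i * pathTotal x (b + 1) - pathEnd x (b + 1) i := by
    intro b i
    rw [pathEnd_succ]
    ring
  have hsum : ∀ b, ∑ i, pathEnd x b i = pathTotal x (b + 1) := fun _ => rfl
  induction a generalizing b with
  | zero =>
    simp only [pathEnd, hx, Finset.sum_sub_distrib, ← Finset.sum_mul, hsum, zero_add]
    rfl
  | succ a ih =>
    have h : ∀ i, pathEnd x (a + 1) i * pathEnd x b i = pathEnd x a i * pathEnd x (b + 1) i +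
        (pathTotal x (b + 1) * pathEnd x (a + 1) i -
          pathTotal x (a + 1) * pathEnd x (b + 1) i) := by
      intro i
      simp only [pathEnd_succ]
      ring
    simp only [h, Finset.sum_add_distrib, Finset.sum_sub_distrib, ← Finset.mul_sum, ih, hsum]
    rw [show a + (b + 1) + 2 = a + 1 + b + 2 by ring]
    ring

theorem sum_pathEnd_triangle [DecidableEq ι] (x : ι → R) (a b : ℕ) :
    ∑ i, ∑ c, ∑ j, (if i ≠ c ∧ c ≠ j ∧ i ≠ j then
        pathEnd x a i * x c * pathEnd x b j else 0) =
      2 * pathTotal x (a + b + 3) + elemSymmFin x 1 * pathTotal x (a + b + 2) -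
        pathTotal x (a + 1) * pathTotal x (b + 2) -
        pathTotal x (a + 2) * pathTotal x (b + 1) := by
  have hsum : ∀ b, ∑ i, pathEnd x b i = pathTotal x (b + 1) := fun _ => rfl
  -- For `i ≠ j` the sum over `c` gives `e_1 - x_i - x_j`; the last term removes the diagonal `i =
  -- j`.
  have h1 : ∀ i j, ∑ c, (if i ≠ c ∧ c ≠ j ∧ i ≠ j then
      pathEnd x a i * x c * pathEnd x b j else 0) =
      pathEnd x a i * pathEnd x b j * elemSymmFin x 1 -
        (x i * pathEnd x a i) * pathEnd x b j - pathEnd x a i * (x j * pathEnd x b j) -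
        if i = j then pathEnd x a i * pathEnd x b i * elemSymmFin x 1 -
          2 * (x i * pathEnd x a i) * pathEnd x b i else 0 := by
    intro i j
    by_cases hij : i = j
    · subst hij
      simp
      ring
    · have : ∀ c, (if i ≠ c ∧ c ≠ j ∧ i ≠ j then pathEnd x a i * x c * pathEnd x b j else 0) =
          pathEnd x a i * x c * pathEnd x b j -
            (if i = c then pathEnd x a i * x c * pathEnd x b j else 0) -
            (if j = c then pathEnd x a i * x c * pathEnd x b j else 0) := by
        intro c
        by_cases hi : i = c
        · have : j ≠ c := by rintro rfl; exact hij hi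
          simp [hi, this]
        · by_cases hj : j = c
          · simp [hi, hj]
          · simp [hi, hj, hij, Ne.symm hj]
      simp only [this, Finset.sum_sub_distrib, Finset.sum_ite_eq, Finset.mem_univ, if_true, hij,
        if_false, ← Finset.sum_mul, ← Finset.mul_sum, sum_eq_elemSymmFin_one]
      ring
  have h2 : ∀ i, ∑ c, ∑ j, (if i ≠ c ∧ c ≠ j ∧ i ≠ j then
        pathEnd x a i * x c * pathEnd x b j else 0) =
      elemSymmFin x 1 * (pathTotal x (b + 1) * pathEnd x a i - pathEnd x a i * pathEnd x b i) -
        pathEnd x a i * pathEnd x (b + 1) i - pathEnd x a i * ∑ j, x j * pathEnd x b j +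
        x i * pathEnd x b i * pathEnd x a i := by
    intro i
    rw [Finset.sum_comm]
    simp only [h1, Finset.sum_sub_distrib, Finset.sum_ite_eq, Finset.mem_univ, if_true,
      ← Finset.mul_sum, ← Finset.sum_mul, hsum, pathEnd_succ]
    ring
  -- The diagonal left two copies of `x_i` times both path ends: one completes `pathEnd x (b + 1) i`
  -- in `h2`, the other completes `pathEnd x (a + 1) i` here.
  have h3 : ∑ i, pathEnd x (a + 1) i * pathEnd x b i =
      (∑ i, x i * pathEnd x b i) * pathTotal x (a + 1) -
        ∑ i, x i * pathEnd x b i * pathEnd x a i := by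
    rw [Finset.sum_mul, ← Finset.sum_sub_distrib]
    refine Finset.sum_congr rfl fun i _ => ?_
    rw [pathEnd_succ]
    ring
  simp only [h2, Finset.sum_add_distrib, Finset.sum_sub_distrib, ← Finset.mul_sum,
    ← Finset.sum_mul, hsum]
  have h4 := sum_pathEnd_mul_pathEnd x a (b + 1)
  have h5 := sum_pathEnd_mul_pathEnd x (a + 1) b
  rw [h3, show a + 1 + b + 2 = a + b + 3 by ring] at h5
  rw [show a + (b + 1) + 2 = a + b + 3 by ring] at h4
  rw [sum_pathEnd_mul_pathEnd x a b, h4]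
  linear_combination -h5

/-! ### Colorings of the bull as pairs of words and a color. -/

/-- A word no two consecutive letters of which agree. -/
def IsProperWord {ι : Type*} {m : ℕ} (κ : Fin (m + 1) → ι) : Prop :=
  ∀ i : Fin m, κ i.castSucc ≠ κ i.succ

theorem isProperWord_cons {ι : Type*} {m : ℕ} (i : ι) (κ : Fin (m + 1) → ι) :
    IsProperWord (Fin.cons i κ : Fin (m + 2) → ι) ↔ i ≠ κ 0 ∧ IsProperWord κ := by
  rw [IsProperWord, Fin.forall_fin_succ]
  refine and_congr (by simp) (forall_congr' fun j => ?_)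
  rw [Fin.castSucc_succ]
  simp

open Classical in
-- The test function `f` makes the induction work: summing out the first letter replaces `f` by `j ↦
-- ∑_{i ≠ j} x_i f(i)`, evaluated at the next letter.
theorem sum_isProperWord (x f : ι → R) (m : ℕ) :
    ∑ κ : Fin (m + 1) → ι, (if IsProperWord κ then (∏ v, x (κ v)) * f (κ 0) else 0) =
      ∑ i, pathEnd x m i * f i := by
  induction m generalizing f with
  | zero =>
    rw [← (Equiv.funUnique (Fin 1) ι).symm.sum_comp]
    refine Finset.sum_congr rfl fun i _ => ?_
    rw [if_pos (show IsProperWord (m := 0) _ from fun j => j.elim0)]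
    simp [pathEnd]
  | succ m ih =>
    have h : ∀ κ : Fin (m + 1) → ι, ∑ i, (if IsProperWord (Fin.cons i κ : Fin (m + 2) → ι) then
        (∏ v, x ((Fin.cons i κ : Fin (m + 2) → ι) v)) * f i else 0) =
        if IsProperWord κ then (∏ v, x (κ v)) * (∑ i, x i * f i - x (κ 0) * f (κ 0)) else 0 := by
      intro κ
      by_cases hκ : IsProperWord κ
      · simp only [isProperWord_cons, hκ, and_true, if_true, Fin.prod_univ_succ (n := m + 1),
          Fin.cons_zero, Fin.cons_succ]
        rw [← Finset.sum_filter, Finset.filter_ne', ← Finset.sum_erase_add _ _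
          (Finset.mem_univ (κ 0)), add_sub_cancel_right, Finset.mul_sum]
        exact Finset.sum_congr rfl fun i _ => by ring
      · simp [isProperWord_cons, hκ]
    refine (Fintype.sum_equiv (Fin.consEquiv fun _ => ι)
      (fun p : ι × (Fin (m + 1) → ι) => if IsProperWord (Fin.cons p.1 p.2 : Fin (m + 2) → ι) then
        (∏ v, x ((Fin.cons p.1 p.2 : Fin (m + 2) → ι) v)) * f p.1 else 0) _
      fun _ => rfl).symm.trans ?_
    rw [Fintype.sum_prod_type, Finset.sum_comm]
    simp only [h]
    rw [ih fun j => ∑ i, x i * f i - x j * f j]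
    simp only [mul_sub, Finset.sum_sub_distrib, ← Finset.sum_mul]
    rw [Finset.mul_sum, ← Finset.sum_sub_distrib]
    refine Finset.sum_congr rfl fun i _ => ?_
    rw [pathEnd]
    ring

open Classical in
/-- The chromatic symmetric function in finitely many variables. -/
noncomputable def chromaticFin {V : Type*} [Fintype V] (G : SimpleGraph V) (x : ι → R) : R :=
  ∑ κ : V → ι, if ∀ u v, G.Adj u v → κ u ≠ κ v then ∏ v, x (κ v) else 0

/-- Two paths whose first vertices form a triangle with a further vertex. -/
def bullGraph (a b : ℕ) : SimpleGraph (Fin (a + 1) ⊕ (Unit ⊕ Fin (b + 1))) :=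
  SimpleGraph.fromRel fun u v =>
    match u, v with
    | .inl i, .inl j => (i : ℕ) + 1 = j
    | .inl i, .inr (.inl _) => (i : ℕ) = 0
    | .inl i, .inr (.inr j) => (i : ℕ) = 0 ∧ (j : ℕ) = 0
    | .inr (.inl _), .inr (.inr j) => (j : ℕ) = 0
    | .inr (.inr i), .inr (.inr j) => (i : ℕ) + 1 = j
    | _, _ => False

theorem bullGraph_proper_iff {ι : Type*} {a b : ℕ} (κ₁ : Fin (a + 1) → ι) (c : ι) (κ₂ : Fin (b + 1) → ι) :
    (∀ u v, (bullGraph a b).Adj u v →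
      (Sum.elim κ₁ (Sum.elim (fun _ => c) κ₂) u : ι) ≠ Sum.elim κ₁ (Sum.elim (fun _ => c) κ₂) v) ↔
      IsProperWord κ₁ ∧ IsProperWord κ₂ ∧ κ₁ 0 ≠ c ∧ c ≠ κ₂ 0 ∧ κ₁ 0 ≠ κ₂ 0 := by
  constructor
  · intro h
    refine ⟨fun i => h (.inl i.castSucc) (.inl i.succ) ?_,
      fun i => h (.inr (.inr i.castSucc)) (.inr (.inr i.succ)) ?_,
      h (.inl 0) (.inr (.inl ())) ⟨by simp, Or.inl rfl⟩,
      h (.inr (.inl ())) (.inr (.inr 0)) ⟨by simp, Or.inl rfl⟩,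
      h (.inl 0) (.inr (.inr 0)) ⟨by simp, Or.inl ⟨rfl, rfl⟩⟩⟩
    · exact ⟨fun h => by simpa using congrArg Fin.val (Sum.inl.inj h), Or.inl rfl⟩
    · exact ⟨fun h => by simpa using congrArg Fin.val (Sum.inr.inj (Sum.inr.inj h)), Or.inl rfl⟩
  · rintro ⟨h1, h2, h3, h4, h5⟩
    have key : ∀ {m : ℕ} {κ : Fin (m + 1) → ι}, IsProperWord κ → ∀ i j : Fin (m + 1),
        (i : ℕ) + 1 = j → κ i ≠ κ j := by
      intro m κ h i j hij
      have hi : (i : ℕ) < m := by omega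
      have := h ⟨i, hi⟩
      rwa [show (⟨i, hi⟩ : Fin m).castSucc = i from rfl,
        show (⟨i, hi⟩ : Fin m).succ = j from Fin.ext (by simpa using hij)] at this
    have z : ∀ {m : ℕ} {i : Fin (m + 1)}, (i : ℕ) = 0 → i = 0 := fun h => Fin.ext h
    rintro (i | i | i) (j | j | j) hadj <;>
      simp only [bullGraph, SimpleGraph.fromRel_adj, or_false, false_or, and_false] at hadj <;>
      simp only [Sum.elim_inl, Sum.elim_inr]
    · rcases hadj.2 with h | h
      exacts [key h1 i j h, (key h1 j i h).symm]
    · rw [z hadj.2]; exact h3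
    · rw [z hadj.2.1, z hadj.2.2]; exact h5
    · rw [z hadj.2]; exact h3.symm
    · rw [z hadj.2]; exact h4
    · rw [z hadj.2.1, z hadj.2.2]; exact h5.symm
    · rw [z hadj.2]; exact h4.symm
    · rcases hadj.2 with h | h
      exacts [key h2 i j h, (key h2 j i h).symm]

theorem chromaticFin_bullGraph (x : ι → R) (a b : ℕ) :
    chromaticFin (bullGraph a b) x =
      2 * pathTotal x (a + b + 3) + elemSymmFin x 1 * pathTotal x (a + b + 2) -
        pathTotal x (a + 1) * pathTotal x (b + 2) -
        pathTotal x (a + 2) * pathTotal x (b + 1) := by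
  classical
  rw [← sum_pathEnd_triangle, chromaticFin]
  let ε : (Fin (a + 1) → ι) × (ι × (Fin (b + 1) → ι)) ≃
      (Fin (a + 1) ⊕ (Unit ⊕ Fin (b + 1)) → ι) :=
    (Equiv.prodCongr (Equiv.refl _) ((Equiv.prodCongr (Equiv.funUnique Unit ι).symm
      (Equiv.refl _)).trans (Equiv.sumArrowEquivProdArrow _ _ _).symm)).trans
      (Equiv.sumArrowEquivProdArrow _ _ _).symm
  have hε : ∀ κ₁ c κ₂, ε (κ₁, c, κ₂) = Sum.elim κ₁ (Sum.elim (fun _ => c) κ₂) := by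
    intro κ₁ c κ₂; rfl
  trans ∑ p, if ∀ u v, (bullGraph a b).Adj u v → ε p u ≠ ε p v then ∏ v, x (ε p v) else 0
  · refine Finset.sum_equiv ε.symm (by simp) fun κ _ => ?_
    simp only [Equiv.apply_symm_apply]
  rw [Fintype.sum_prod_type]
  simp only [Fintype.sum_prod_type, hε, bullGraph_proper_iff, Fintype.prod_sum_type,
    Sum.elim_inl, Sum.elim_inr, Finset.univ_unique, Finset.prod_singleton]
  have h1 : ∀ (κ₁ : Fin (a + 1) → ι) (c : ι), ∑ κ₂ : Fin (b + 1) → ι,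
      (if IsProperWord κ₁ ∧ IsProperWord κ₂ ∧ κ₁ 0 ≠ c ∧ c ≠ κ₂ 0 ∧ κ₁ 0 ≠ κ₂ 0 then
        (∏ v, x (κ₁ v)) * (x c * ∏ v, x (κ₂ v)) else 0) =
      if IsProperWord κ₁ then (∏ v, x (κ₁ v)) * ∑ j, pathEnd x b j *
        (if κ₁ 0 ≠ c ∧ c ≠ j ∧ κ₁ 0 ≠ j then x c else 0) else 0 := by
    intro κ₁ c
    by_cases h : IsProperWord κ₁
    · rw [if_pos h, ← sum_isProperWord x (fun j => if κ₁ 0 ≠ c ∧ c ≠ j ∧ κ₁ 0 ≠ j then x c else 0),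
        Finset.mul_sum]
      refine Finset.sum_congr rfl fun κ₂ _ => ?_
      simp only [h, true_and, ite_and]
      split_ifs <;> ring
    · simp [h]
  simp only [h1]
  have h2 : ∀ κ₁ : Fin (a + 1) → ι, (∑ c, if IsProperWord κ₁ then
      (∏ v, x (κ₁ v)) * ∑ j, pathEnd x b j *
        (if κ₁ 0 ≠ c ∧ c ≠ j ∧ κ₁ 0 ≠ j then x c else 0) else 0) =
      if IsProperWord κ₁ then (∏ v, x (κ₁ v)) * (fun i => ∑ c, ∑ j, pathEnd x b j *
        (if i ≠ c ∧ c ≠ j ∧ i ≠ j then x c else 0)) (κ₁ 0) else 0 := by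
    intro κ₁
    split_ifs
    · rw [Finset.mul_sum]
    · simp
  simp only [h2]
  rw [sum_isProperWord x fun i => ∑ c, ∑ j, pathEnd x b j *
    (if i ≠ c ∧ c ≠ j ∧ i ≠ j then x c else 0)]
  simp only [Finset.mul_sum]
  refine Finset.sum_congr rfl fun i _ => Finset.sum_congr rfl fun c _ =>
    Finset.sum_congr rfl fun j _ => ?_
  split_ifs <;> ring

end FiniteVariables

theorem chromaticFin_iso {ι R V W : Type*} [Fintype ι] [CommRing R] [Fintype V] [Fintype W]
    {G : SimpleGraph V} {H : SimpleGraph W} (φ : G ≃g H) (x : ι → R) :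
    chromaticFin G x = chromaticFin H x := by
  classical
  rw [chromaticFin, chromaticFin]
  apply Fintype.sum_equiv (Equiv.arrowCongr φ.toEquiv (Equiv.refl ι))
  intro κ
  have hs : ∀ v, φ.toEquiv.symm (φ v) = v := φ.toEquiv.symm_apply_apply
  have hs' : ∀ v, φ.toEquiv.symm (φ.toEquiv v) = v := φ.toEquiv.symm_apply_apply
  have hp : (∀ u v, G.Adj u v → κ u ≠ κ v) ↔ ∀ u v, H.Adj u v →
      Equiv.arrowCongr φ.toEquiv (Equiv.refl ι) κ u ≠
        Equiv.arrowCongr φ.toEquiv (Equiv.refl ι) κ v := by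
    constructor
    · intro h u v huv
      exact h _ _ (φ.symm.map_adj_iff.2 huv)
    · intro h u v huv
      have := h (φ u) (φ v) (φ.map_adj_iff.2 huv)
      simpa only [Equiv.arrowCongr_apply, Function.comp_apply, Equiv.refl_apply,
        RelIso.coe_fn_toEquiv, RelIso.symm_apply_apply, hs] using this
  have he : ∏ v, x (κ v) = ∏ v, x (Equiv.arrowCongr φ.toEquiv (Equiv.refl ι) κ v) :=
    Fintype.prod_equiv φ.toEquiv _ _ fun v => by
      simp only [Equiv.arrowCongr_apply, Function.comp_apply, Equiv.refl_apply, hs']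
  simp only [hp, he]

/-! ### The `K`-chain as a path with a chord. -/

section KChain

variable {a n : ℕ} (h : a + 2 ≤ n)

theorem bullComposition_blocksFun (j : Fin (bullComposition a n h).length) :
    (bullComposition a n h).blocksFun j = if (j : ℕ) = a then 2 else 1 := by
  change (List.replicate a 1 ++ 2 :: List.replicate (n - a - 2) 1)[(j : ℕ)]'_ = _
  simp only [List.getElem_append,
    List.length_replicate, List.getElem_cons, List.getElem_replicate]
  split_ifs <;> omega

theorem bullComposition_sizeUpTo (j : Fin (bullComposition a n h).length) :
    (bullComposition a n h).sizeUpTo j = if (j : ℕ) ≤ a then (j : ℕ) else j + 1 := by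
  have hj : (j : ℕ) < a + 1 + (n - a - 2) := by
    have := j.2
    simp only [Composition.length, bullComposition, List.length_append, List.length_cons,
      List.length_replicate] at this
    omega
  simp only [Composition.sizeUpTo, bullComposition, List.take_append, List.length_replicate,
    List.take_replicate, List.sum_append, List.sum_replicate, smul_eq_mul, mul_one]
  split_ifs with h1
  · rw [Nat.sub_eq_zero_of_le h1]
    simp [h1]
  · obtain ⟨m, hm⟩ : ∃ m, (j : ℕ) - a = m + 1 := ⟨(j : ℕ) - a - 1, by omega⟩
    rw [hm]
    simp only [List.take_succ_cons, List.take_replicate, List.sum_cons, List.sum_replicate,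
      smul_eq_mul, mul_one]
    omega

/-- Numbering the vertices block by block turns the `K`-chain into the path through consecutive
numbers with one chord, between `a - 1` and `a + 1`. -/
theorem kChain_bullComposition_adj
    (u v : Σ j : Fin (bullComposition a n h).length, Fin ((bullComposition a n h).blocksFun j)) :
    (kChain (bullComposition a n h)).Adj u v ↔
      let s : ℕ := (bullComposition a n h).blocksFinEquiv u
      let t : ℕ := (bullComposition a n h).blocksFinEquiv v
      s + 1 = t ∨ t + 1 = s ∨ (s + 1 = a ∧ t = a + 1) ∨ (t + 1 = a ∧ s = a + 1) := by
  have hne : u ≠ v ↔ ((bullComposition a n h).blocksFinEquiv u : ℕ) ≠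
      (bullComposition a n h).blocksFinEquiv v := by
    rw [Ne, Ne, ← Fin.ext_iff, EmbeddingLike.apply_eq_iff_eq]
  have hpos : ∀ w, ((bullComposition a n h).blocksFinEquiv w : ℕ) =
      (bullComposition a n h).sizeUpTo w.1 + w.2 := fun w => by
    simp [Composition.blocksFinEquiv]
  have hu := u.2.2
  have hv := v.2.2
  simp only [kChain, hne, hpos, Fin.ext_iff]
  rw [bullComposition_sizeUpTo, bullComposition_sizeUpTo]
  simp only [bullComposition_blocksFun] at hu hv ⊢
  split_ifs at hu hv ⊢ <;> omega

end KChain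

/-- The `K`-chain `1^{a+1} 2 1^{b}` is the graph `bullGraph a b`. -/
theorem nonempty_bullGraph_iso_kChain (a b n : ℕ) (hab : n = a + b + 3) (h : a + 1 + 2 ≤ n) :
    Nonempty (bullGraph a b ≃g kChain (bullComposition (a + 1) n h)) := by
  -- The first tail is numbered backwards, so that its vertex 0 lands at position `a`, next to the
  -- third corner of the triangle at `a + 1`.
  let f : Fin (a + 1) ⊕ (Unit ⊕ Fin (b + 1)) → Fin n := fun u =>
    match u with
    | .inl i => ⟨a - i, by omega⟩
    | .inr (.inl _) => ⟨a + 1, by omega⟩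
    | .inr (.inr j) => ⟨a + 2 + j, by omega⟩
  have hf : Function.Bijective f := by
    rw [Fintype.bijective_iff_injective_and_card]
    refine ⟨?_, by simp; omega⟩
    rintro (i | i | i) (j | j | j) hij <;> simp only [f, Fin.mk.injEq] at hij
    · exact congrArg _ (Fin.ext (by omega))
    · omega
    · omega
    · omega
    · rfl
    · omega
    · omega
    · omega
    · exact congrArg _ (congrArg _ (Fin.ext (by omega)))
  refine ⟨⟨(Equiv.ofBijective f hf).trans (bullComposition (a + 1) n h).blocksFinEquiv.symm, ?_⟩⟩
  intro u v
  rw [kChain_bullComposition_adj]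
  simp only [Equiv.trans_apply, Equiv.apply_symm_apply, Equiv.ofBijective_apply]
  rcases u with i | ⟨⟩ | i <;> rcases v with j | ⟨⟩ | j <;>
    simp only [f, bullGraph, SimpleGraph.fromRel_adj, ne_eq, Sum.inl.injEq, Sum.inr.injEq,
      reduceCtorEq, not_false_eq_true, not_true_eq_false, true_and, false_and, or_false, false_or,
      Fin.ext_iff] <;> first | omega | simp

/-! ### Reduction to finitely many variables. -/

section Truncation

open MvPowerSeries

/-- `f` and `g` agree on the monomials in the variables `x_j` with `j < N`. -/
def AgreeBelow (N : ℕ) (f g : MvPowerSeries ℕ ℚ) : Prop :=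
  ∀ d : ℕ →₀ ℕ, (∀ j, N ≤ j → d j = 0) → coeff d f = coeff d g

namespace AgreeBelow

variable {N : ℕ} {f f' g g' : MvPowerSeries ℕ ℚ}

theorem add (hf : AgreeBelow N f f') (hg : AgreeBelow N g g') :
    AgreeBelow N (f + g) (f' + g') := fun d hd => by
  rw [map_add, map_add, hf d hd, hg d hd]

theorem smul (c : ℚ) (hf : AgreeBelow N f f') : AgreeBelow N (c • f) (c • f') := fun d hd => by
  rw [coeff_smul, coeff_smul, hf d hd]

/-- Exponents are nonnegative, so any splitting of a monomial in the first `N` variables uses only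
these variables. -/
theorem mul (hf : AgreeBelow N f f') (hg : AgreeBelow N g g') :
    AgreeBelow N (f * g) (f' * g') := fun d hd => by
  classical
  rw [coeff_mul, coeff_mul]
  refine Finset.sum_congr rfl fun p hp => ?_
  rw [Finset.HasAntidiagonal.mem_antidiagonal] at hp
  have key : ∀ j, N ≤ j → p.1 j = 0 ∧ p.2 j = 0 := by
    intro j hj
    have := hd j hj
    rw [← hp, Finsupp.add_apply] at this
    omega
  rw [hf _ fun j hj => (key j hj).1, hg _ fun j hj => (key j hj).2]

theorem sum {α : Type*} (s : Finset α) {F G : α → MvPowerSeries ℕ ℚ}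
    (h : ∀ i ∈ s, AgreeBelow N (F i) (G i)) : AgreeBelow N (∑ i ∈ s, F i) (∑ i ∈ s, G i) :=
  fun d hd => by
    rw [map_sum, map_sum]
    exact Finset.sum_congr rfl fun i hi => h i hi d hd

theorem list_prod (l : List ℕ) {F G : ℕ → MvPowerSeries ℕ ℚ} (h : ∀ i, AgreeBelow N (F i) (G i)) :
    AgreeBelow N (l.map F).prod (l.map G).prod := by
  induction l with
  | nil => exact fun d _ => rfl
  | cons i l ih => simpa using (h i).mul ih

end AgreeBelow

/-- The first `N` variables. -/
noncomputable def firstVars (N : ℕ) (i : Fin N) : MvPowerSeries ℕ ℚ := X (i : ℕ)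

theorem coeff_prod_firstVars {N : ℕ} {α : Type*} (s : Finset α) (κ : α → Fin N) (d : ℕ →₀ ℕ)
    [Decidable (∑ v ∈ s, Finsupp.single (κ v : ℕ) 1 = d)] :
    coeff d (∏ v ∈ s, firstVars N (κ v)) =
      if ∑ v ∈ s, Finsupp.single (κ v : ℕ) 1 = d then 1 else 0 := by
  classical
  have h : ∏ v ∈ s, firstVars N (κ v) =
      monomial (∑ v ∈ s, Finsupp.single (κ v : ℕ) 1) (1 : ℚ) := by
    induction s using Finset.induction_on with
    | empty => simp [monomial_zero_one]
    | insert i s hi ih =>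
      rw [Finset.prod_insert hi, Finset.sum_insert hi, ih, firstVars, X_def, monomial_mul_monomial,
        one_mul]
  rw [h, coeff_monomial]
  simp only [eq_comm]

theorem agreeBelow_chromaticSymm {V : Type*} [Fintype V] (G : SimpleGraph V) (N : ℕ) :
    AgreeBelow N (chromaticSymm G) (chromaticFin G (firstVars N)) := by
  classical
  intro d hd
  have h1 : coeff d (chromaticFin G (firstVars N)) = ((Finset.univ.filter fun κ : V → Fin N =>
      (∀ u v, G.Adj u v → κ u ≠ κ v) ∧ colorMonomial (fun v => (κ v : ℕ)) = d).card : ℚ) := by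
    rw [chromaticFin, map_sum, Finset.card_eq_sum_ones, Finset.sum_filter]
    push_cast
    refine Finset.sum_congr (by congr) fun κ _ => ?_
    rw [ite_and, colorMonomial]
    split_ifs with h h'
    · rw [coeff_prod_firstVars, if_pos h']
    · rw [coeff_prod_firstVars, if_neg h']
    · simp
  -- A color at least `N` would give `d` a positive exponent there, so the colorings counted use
  -- only `Fin N`.
  have key : ∀ (κ : V → ℕ), colorMonomial κ = d → ∀ v, κ v < N := by
    rintro κ rfl v
    by_contra hv
    have h0 := hd (κ v) (by omega)
    rw [colorMonomial, Finsupp.finsetSum_apply] at h0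
    have := Finset.sum_eq_zero_iff.1 h0 v (Finset.mem_univ v)
    simp at this
  rw [h1]
  change ((Nat.card {κ : G.Coloring ℕ // colorMonomial κ = d} : ℕ) : ℚ) = _
  norm_cast
  rw [← Fintype.card_subtype, ← Nat.card_eq_fintype_card]
  refine Nat.card_congr
    { toFun := fun κ => ⟨fun v => ⟨κ.1 v, key _ κ.2 v⟩, fun u v huv h =>
        κ.1.valid huv (congrArg Fin.val h), κ.2⟩
      invFun := fun κ => ⟨SimpleGraph.Coloring.mk (fun v => (κ.1 v : ℕ)) fun {u v} huv h =>
        κ.2.1 u v huv (Fin.ext h), κ.2.2⟩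
      left_inv := fun κ => by rfl
      right_inv := fun κ => by rfl }

theorem elemSymmFin_eq_sum {ι R : Type*} [Fintype ι] [CommRing R] (x : ι → R) (k : ℕ) :
    elemSymmFin x k = ∑ t : Finset ι, if t.card = k then ∏ i ∈ t, x i else 0 := by
  classical
  rw [elemSymmFin, Finset.prod_one_add, Finset.powerset_univ, Polynomial.finsetSum_coeff]
  refine Finset.sum_congr rfl fun t _ => ?_
  rw [Finset.prod_mul_distrib, Finset.prod_const, ← map_prod, Polynomial.coeff_C_mul,
    Polynomial.coeff_X_pow]
  simp [eq_comm]

theorem agreeBelow_elemSymm (N k : ℕ) :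
    AgreeBelow N (elemSymm k) (elemSymmFin (firstVars N) k) := by
  classical
  intro d hd
  have happ : ∀ (t : Finset (Fin N)) (i : Fin N),
      (∑ v ∈ t, Finsupp.single (v : ℕ) 1 : ℕ →₀ ℕ) i = if i ∈ t then 1 else 0 := by
    intro t i
    simp [Finsupp.finsetSum_apply, Finsupp.single_apply, ← Fin.ext_iff]
  have hdeg : ∀ t : Finset (Fin N),
      (∑ v ∈ t, Finsupp.single (v : ℕ) 1 : ℕ →₀ ℕ).degree = t.card := by
    intro t
    simp [map_sum]
  rw [elemSymmFin_eq_sum, map_sum]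
  have h1 : ∀ t : Finset (Fin N),
      coeff d (if t.card = k then ∏ i ∈ t, firstVars N i else 0) =
        if t.card = k ∧ ∑ v ∈ t, Finsupp.single (v : ℕ) 1 = d then (1 : ℚ) else 0 := by
    intro t
    rw [ite_and]
    split_ifs with h h'
    · rw [coeff_prod_firstVars, if_pos h']
    · rw [coeff_prod_firstVars, if_neg h']
    · simp
  simp only [h1]
  change (if (∀ j, d j ≤ 1) ∧ d.degree = k then (1 : ℚ) else 0) = _
  by_cases hsf : ∀ j, d j ≤ 1
  -- A squarefree monomial in the first `N` variables comes from exactly one subset, namely its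
  -- support.
  · set t₀ : Finset (Fin N) := Finset.univ.filter fun i => d i = 1 with ht₀
    have hd₀ : ∑ v ∈ t₀, Finsupp.single (v : ℕ) 1 = d := by
      ext j
      by_cases hj : j < N
      · have := happ t₀ ⟨j, hj⟩
        dsimp only at this
        rw [this]
        have := hsf j
        simp only [ht₀, Finset.mem_filter, Finset.mem_univ, true_and]
        split_ifs <;> omega
      · rw [hd j (by omega), Finsupp.finsetSum_apply]
        refine Finset.sum_eq_zero fun i _ => ?_
        rw [Finsupp.single_apply, if_neg (by omega)]
    rw [Finset.sum_eq_single t₀]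
    · have := hdeg t₀
      rw [hd₀] at this
      simp [hsf, hd₀, this]
    · intro t _ ht
      rw [if_neg]
      rintro ⟨-, h⟩
      apply ht
      ext i
      have h2 := happ t i
      have h3 := happ t₀ i
      rw [h] at h2
      rw [hd₀, h2] at h3
      by_cases h4 : i ∈ t <;> by_cases h5 : i ∈ t₀ <;> simp_all
    · simp
  · rw [if_neg fun h => hsf h.1, Finset.sum_eq_zero]
    intro t _
    rw [if_neg]
    rintro ⟨-, rfl⟩
    apply hsf
    intro j
    by_cases hj : j < N
    · have := happ t ⟨j, hj⟩
      dsimp only at this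
      rw [this]
      split_ifs <;> omega
    · rw [hd j (by omega)]
      omega

end Truncation

theorem mainTheorem5 (a n : ℕ) (ha : 1 ≤ a) (hn : a + 2 ≤ n) :
    chromaticSymm (kChain (bullComposition a n hn)) =
      (∑ I : Composition n with 3 ≤ lastPart I ∧ surplus I a ≤ 1,
        ((((lastPart I : ℚ) - 2) / ((lastPart I : ℚ) - 1)) * compWeight I) • elemSymmComp I) +
      (∑ I : Composition n with 2 ≤ surplus I a, (2 * compWeight I) • elemSymmComp I) +
      (∑ J : Composition (n - 1) with 2 ≤ surplus J a,
        compWeight J • elemSymmComp (J.append (Composition.single 1 one_pos))) := by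
  refine MvPowerSeries.ext fun d => ?_
  -- `N` bounds the variables in the monomial `d`, so its coefficient can be computed after
  -- truncation.
  obtain ⟨N, hN⟩ : ∃ N, ∀ j, N ≤ j → d j = 0 := by
    refine ⟨d.support.sup id + 1, fun j hj => ?_⟩
    by_contra h
    have : j ≤ d.support.sup id :=
      Finset.le_sup (f := id) (Finsupp.mem_support_iff.2 h)
    omega
  obtain ⟨a, rfl⟩ : ∃ a', a = a' + 1 := ⟨a - 1, by omega⟩
  obtain ⟨b, rfl⟩ : ∃ b, n = a + b + 3 := ⟨n - a - 3, by omega⟩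
  obtain ⟨φ⟩ := nonempty_bullGraph_iso_kChain a b _ rfl hn
  have hcomb := bull_combination_eq (e := elemSymmFin (firstVars N))
    (P := pathTotal (firstVars N)) rfl (fun n _ => pathTotal_rec _ n) ha hn
  have he : ∀ {m : ℕ} (I : Composition m), AgreeBelow N (elemSymmComp I)
      (I.blocks.map (elemSymmFin (firstVars N))).prod :=
    fun I => AgreeBelow.list_prod _ (agreeBelow_elemSymm N)
  rw [agreeBelow_chromaticSymm _ N d hN, ← chromaticFin_iso φ, chromaticFin_bullGraph]
  rw [show a + b + 3 - 1 = a + b + 2 by omega, show a + b + 3 - (a + 1) = b + 2 by omega,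
    show b + 2 - 1 = b + 1 by omega] at hcomb
  rw [hcomb]
  refine (((AgreeBelow.sum _ fun I _ => (he I).smul _).add
    (AgreeBelow.sum _ fun I _ => (he I).smul _)).add
    (AgreeBelow.sum _ fun J _ => (he _).smul _) d hN).symm
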